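/- Let $(\mathcal K,[\cdot,\cdot])$ be a Krein space over $\mathbb C$, i.e. a complex vector space with a non-degenerate Hermitian sesquilinear form which admits a decomposition $\mathcal K=\mathcal K_+\dotplus\mathcal K_-$, direct and $[\cdot,\cdot]$-orthogonal, such that $(\mathcal K_+,[\cdot,\cdot])$ and $(\mathcal K_-,-[\cdot,\cdot])$ are Hilbert spaces; $\mathcal K$ carries the topology of the Hilbert space norm $\|x_++x_-\|^2=[x_+,x_+]-[x_-,x_-]$. Let $A$ be a bounded non-negative operator in $\mathcal K$, i.e. a bounded everywhere defined operator with $[Ax,y]=[x,Ay]$ and $[Ax,x]\ge 0$ for all $x,y\in\mathcal K$, and let $$W_{\rm co}(A)=\left\{\frac{[Ax,Ax]}{[Ax,x]} : x\in\mathcal K,\ Ax\neq 0\right\}.$$ Let $\widetilde{\mathcal K}$ be the completion of $\mathcal K_0=\mathcal K/\ker A$ with respect to the positive definite inner product $\langle [x],[y]\rangle=[Ax,y]$, and let $\widetilde A$ be the bounded selfadjoint extension to $\widetilde{\mathcal K}$ of the bounded symmetric operator $A_0[x]=[Ax]$ in $\mathcal K_0$. Write $\mathbb R^+=(0,\infty)$,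 $\mathbb R^-=(-\infty,0)$, and let $\mu_-=\sup(\sigma(A)\cap\mathbb R^-)$ ($-\infty$ if this set is empty) and $\mu_+=\inf(\sigma(A)\cap\mathbb R^+)$ ($+\infty$ if this set is empty). "Isolated eigenvalue" means an eigenvalue which is an isolated point of $\sigma(A)$. Then $\sigma(A)$ and $\sigma(\widetilde A)$ are subsets of $\mathbb R$. If $A\neq 0$, then $\sigma(A)$ and $\sigma(\widetilde A)$ have a minimum and a maximum, and $$\overline{W_{\rm co}(A)}=[\min\sigma(\widetilde A),\max\sigma(\widetilde A)].$$ If $A\ne 0$ and if zero is not an isolated eigenvalue of $A$ or both $\sigma(A)\cap\mathbb R^+$ and $\sigma(A)\cap\mathbb R^-$ are non-empty, then the following two relations hold: (a) $\min\sigma(\widetilde A)=\min\sigma(A)$; (b) $\max\sigma(\widetilde A)=\max\sigma(A)$. Let zero be an isolated eigenvalue of $A$. Then: (i) If $\sigma(A)\cap\mathbb R^+=\emptyset$ and $\sigma(A)\cap\mathbb R^-\neq\emptyset$, then (a) holds, and (b) holds if and only if $\ker A\neq\ker A^2$. If $\ker A=\ker A^2$, then $\max\sigma(\widetilde A)=\mu_-<0$.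 (ii) If $\sigma(A)\cap\mathbb R^+\neq\emptyset$ and $\sigma(A)\cap\mathbb R^-=\emptyset$, then (b) holds, and (a) holds if and only if $\ker A\neq\ker A^2$. If $\ker A=\ker A^2$, then $\min\sigma(\widetilde A)=\mu_+>0$. (iii) If $\sigma(A)=\{0\}$, then either $A=0$ and $W_{\rm co}(A)=\emptyset$, or $\ker A\neq\ker A^2$ and $W_{\rm co}(A)=\{0\}$. -/

import Mathlib

open Set Filter Topology ComplexConjugate

noncomputable section

/-- A Krein space over `ℂ`: a Hermitian non-degenerate sesquilinear form `[x, y] = form x y`, linear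
in `x` and conjugate linear in `y`, that admits a fundamental decomposition `K = K₊ [∔] K₋` for
which `(K₊, [·,·])` and `(K₋, -[·,·])` are Hilbert spaces. The norm of `K` is any norm that defines
the Krein space topology, i.e. that is equivalent to the Hilbert space norm
`([x₊, x₊] - [x₋, x₋])^{1/2}`. -/
structure KreinSpace (K : Type*) [NormedAddCommGroup K] [NormedSpace ℂ K] where
  form : K →ₗ[ℂ] K →ₗ⋆[ℂ] ℂ
  hermitian : ∀ x y, form y x = conj (form x y)
  nondegenerate : ∀ x, (∀ y, form x y = 0) → x = 0
  /-- Here `P` is `K₊` and `N` is `K₋`. By the last clause, the norm of `K` is equivalent to the form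
  norms on `P` and on `N`, so that completeness may be expressed with the norm of `K`. -/
  exists_fundamental_decomposition : ∃ P N : Submodule ℂ K,
    IsCompl P N ∧ (∀ x ∈ P, ∀ y ∈ N, form x y = 0) ∧
    (∀ x ∈ P, x ≠ 0 → 0 < (form x x).re) ∧ (∀ y ∈ N, y ≠ 0 → (form y y).re < 0) ∧
    IsComplete (P : Set K) ∧ IsComplete (N : Set K) ∧
    ∃ c C : ℝ, 0 < c ∧ ∀ x ∈ P, ∀ y ∈ N,
      c * ‖x + y‖ ^ 2 ≤ (form x x).re - (form y y).re ∧
      (form x x).re - (form y y).re ≤ C * ‖x + y‖ ^ 2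

/-- The real part `σ(T) ∩ ℝ` of the spectrum of a bounded operator. -/
def realSpectrum {E : Type*} [NormedAddCommGroup E] [NormedSpace ℂ E] (T : E →L[ℂ] E) : Set ℝ :=
  {r | (r : ℂ) ∈ spectrum ℂ T}

namespace KreinSpace

variable {K : Type*} [NormedAddCommGroup K] [NormedSpace ℂ K] (𝒦 : KreinSpace K)

/-- A bounded (everywhere defined) non-negative operator in a Krein space. For such an operator,
selfadjointness `A = A⁺` means `[Ax, y] = [x, Ay]` for all `x`, `y`, and the resolvent set is
automatically non-empty. -/
structure BoundedNonneg where
  op : K →L[ℂ] K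
  selfadjoint : ∀ x y, 𝒦.form (op x) y = 𝒦.form x (op y)
  nonneg : ∀ x, 0 ≤ (𝒦.form (op x) x).re

namespace BoundedNonneg

variable {𝒦} (A : 𝒦.BoundedNonneg)

/-- The co-numerical range, a subset of `ℝ` since `[Ax, Ax]` and `[Ax, x]` are real
(and `[Ax, x] ≠ 0` when `Ax ≠ 0`). -/
def coNumericalRange : Set ℝ :=
  {r | ∃ x : K, A.op x ≠ 0 ∧ (r : ℂ) = 𝒦.form (A.op x) (A.op x) / 𝒦.form (A.op x) x}

/-- The semi-definite inner product `[A·, ·]` on `K`. Mathlib's inner products are conjugate linear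
in the first variable, whence the order of the arguments. -/
@[reducible]
def preCore : PreInnerProductSpace.Core ℂ K where
  inner x y := 𝒦.form (A.op y) x
  conj_inner_symm x y := by
    rw [← 𝒦.hermitian, A.selfadjoint]
  re_inner_nonneg x := A.nonneg x
  add_left x y z := by simp
  smul_left x y r := by simp

lemma op_eq_zero_of_form_eq_zero {x : K} (h : 𝒦.form (A.op x) x = 0) : A.op x = 0 := by
  apply 𝒦.nondegenerate
  intro y
  have h1 := @InnerProductSpace.Core.inner_mul_inner_self_le ℂ K _ _ _ A.preCore y x
  have h2 : ‖𝒦.form (A.op x) y‖ * ‖𝒦.form (A.op y) x‖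
      ≤ (𝒦.form (A.op y) y).re * (𝒦.form (A.op x) x).re := h1
  have h3 : 𝒦.form (A.op y) x = conj (𝒦.form (A.op x) y) := by
    rw [← 𝒦.hermitian, A.selfadjoint]
  rw [h3, h] at h2
  simp only [RCLike.norm_conj, Complex.zero_re, mul_zero] at h2
  have h4 : ‖𝒦.form (A.op x) y‖ = 0 := by nlinarith [norm_nonneg (𝒦.form (A.op x) y)]
  simpa using h4

/-- The quotient `K₀ = K / ker A`, to be endowed with the inner product `⟪[x], [y]⟫ = [Ax, y]`. -/
def K₀ : Type _ := K ⧸ A.op.ker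

instance : AddCommGroup A.K₀ := inferInstanceAs (AddCommGroup (K ⧸ A.op.ker))

instance : Module ℂ A.K₀ := inferInstanceAs (Module ℂ (K ⧸ A.op.ker))

/-- The quotient map `x ↦ [x]`. -/
def cls : K →ₗ[ℂ] A.K₀ := A.op.ker.mkQ

lemma cls_surjective : Function.Surjective A.cls := Submodule.mkQ_surjective _

lemma cls_eq_cls {x y : K} : A.cls x = A.cls y ↔ A.op x = A.op y := by
  have h : A.cls x = A.cls y ↔ x - y ∈ A.op.ker := Submodule.Quotient.eq A.op.ker
  rw [h]
  simp [sub_eq_zero]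

/-- The inner product on `K₀`: the value at `([x], [y])`, in Mathlib's order of the arguments,
is `[Ay, x]`. -/
def inner₀ (u v : A.K₀) : ℂ :=
  Quotient.liftOn₂' u v (fun x y => 𝒦.form (A.op y) x) (by
    intro x y x' y' h h'
    have h1 : A.op x = A.op x' := (A.cls_eq_cls).1 (Quotient.sound' h)
    have h2 : A.op y = A.op y' := (A.cls_eq_cls).1 (Quotient.sound' h')
    change 𝒦.form (A.op y) x = 𝒦.form (A.op y') x'
    rw [h2, A.selfadjoint, h1, ← A.selfadjoint])

lemma inner₀_cls (x y : K) : A.inner₀ (A.cls x) (A.cls y) = 𝒦.form (A.op y) x := rfl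

@[reducible]
def core : InnerProductSpace.Core ℂ A.K₀ where
  inner := A.inner₀
  conj_inner_symm u v := by
    obtain ⟨x, rfl⟩ := A.cls_surjective u
    obtain ⟨y, rfl⟩ := A.cls_surjective v
    rw [inner₀_cls, inner₀_cls, ← 𝒦.hermitian, A.selfadjoint]
  re_inner_nonneg u := by
    obtain ⟨x, rfl⟩ := A.cls_surjective u
    exact A.nonneg x
  add_left u v w := by
    obtain ⟨x, rfl⟩ := A.cls_surjective u
    obtain ⟨y, rfl⟩ := A.cls_surjective v
    obtain ⟨z, rfl⟩ := A.cls_surjective w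
    rw [← map_add, inner₀_cls, inner₀_cls, inner₀_cls, map_add]
  smul_left u v r := by
    obtain ⟨x, rfl⟩ := A.cls_surjective u
    obtain ⟨y, rfl⟩ := A.cls_surjective v
    rw [← map_smul, inner₀_cls, inner₀_cls, LinearMap.map_smulₛₗ, smul_eq_mul]
  definite u h := by
    obtain ⟨x, rfl⟩ := A.cls_surjective u
    rw [inner₀_cls] at h
    rw [← map_zero A.cls, cls_eq_cls, map_zero]
    exact A.op_eq_zero_of_form_eq_zero h

instance : NormedAddCommGroup A.K₀ := A.core.toNormedAddCommGroup

instance : InnerProductSpace ℂ A.K₀ := InnerProductSpace.ofCore A.core.toCore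

lemma inner_cls (x y : K) : inner ℂ (A.cls x) (A.cls y) = 𝒦.form (A.op y) x := rfl

lemma norm_cls_sq (x : K) : ‖A.cls x‖ ^ 2 = (𝒦.form (A.op x) x).re := by
  rw [← A.inner_cls, @norm_sq_eq_re_inner ℂ]
  rfl

/-- The operator `A₀ [x] = [Ax]` on `K₀`, as a linear map. -/
def A₀lin : A.K₀ →ₗ[ℂ] A.K₀ :=
  A.op.ker.mapQ A.op.ker A.op.toLinearMap (by
    intro x hx
    simp only [LinearMap.mem_ker, Submodule.mem_comap, ContinuousLinearMap.coe_coe] at hx ⊢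
    rw [hx, map_zero])

lemma A₀lin_cls (x : K) : A.A₀lin (A.cls x) = A.cls (A.op x) := rfl

lemma exists_abs_form_le (𝒦 : KreinSpace K) : ∃ C : ℝ, ∀ z, |(𝒦.form z z).re| ≤ C * ‖z‖ ^ 2 := by
  obtain ⟨P, N, hPN, hort, hP, hN, -, -, c, C, -, hC⟩ := 𝒦.exists_fundamental_decomposition
  refine ⟨C, fun z => ?_⟩
  obtain ⟨x, hx, y, hy, rfl⟩ := Submodule.mem_sup.1
    (hPN.sup_eq_top ▸ Submodule.mem_top : z ∈ P ⊔ N)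
  have h1 : 𝒦.form x y = 0 := hort x hx y hy
  have h2 : 𝒦.form y x = 0 := by rw [𝒦.hermitian, h1, map_zero]
  have h3 : 0 ≤ (𝒦.form x x).re := by
    by_cases h : x = 0
    · simp [h]
    · exact (hP x hx h).le
  have h4 : (𝒦.form y y).re ≤ 0 := by
    by_cases h : y = 0
    · simp [h]
    · exact (hN y hy h).le
  have h5 := (hC x hx y hy).2
  have h6 : (𝒦.form (x + y) (x + y)).re = (𝒦.form x x).re + (𝒦.form y y).re := by
    simp [h1, h2]
  rw [h6, abs_le]
  constructor <;> linarith

lemma exists_norm_cls_le : ∃ D : ℝ, 0 ≤ D ∧ ∀ x, ‖A.cls x‖ ≤ D * ‖x‖ := by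
  obtain ⟨C, hC⟩ := exists_abs_form_le 𝒦
  set E : ℝ := (|C| * (‖A.op‖ + 1) ^ 2) with hE
  have hE0 : 0 ≤ E := by positivity
  refine ⟨√E, Real.sqrt_nonneg _, fun x => ?_⟩
  have key : ‖A.cls x‖ ^ 2 ≤ E * ‖x‖ ^ 2 := by
    rw [norm_cls_sq]
    have h1 := hC (A.op x + x)
    have h2 := hC (A.op x - x)
    have h3 : (𝒦.form x (A.op x)).re = (𝒦.form (A.op x) x).re := by rw [A.selfadjoint]
    have h4 : (𝒦.form (A.op x + x) (A.op x + x)).re - (𝒦.form (A.op x - x) (A.op x - x)).re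
        = 4 * (𝒦.form (A.op x) x).re := by
      simp only [map_add, map_sub, LinearMap.add_apply, LinearMap.sub_apply, Complex.add_re,
        Complex.sub_re]
      rw [h3]
      ring
    have h0 := A.op.le_opNorm x
    have h5 : ‖A.op x + x‖ ^ 2 ≤ (‖A.op‖ + 1) ^ 2 * ‖x‖ ^ 2 := by
      rw [← mul_pow]
      have := norm_add_le (A.op x) x
      gcongr
      linarith
    have h6 : ‖A.op x - x‖ ^ 2 ≤ (‖A.op‖ + 1) ^ 2 * ‖x‖ ^ 2 := by
      rw [← mul_pow]
      have := norm_sub_le (A.op x) x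
      gcongr
      linarith
    have h7 : C * ‖A.op x + x‖ ^ 2 ≤ E * ‖x‖ ^ 2 := by
      rw [hE, mul_assoc]
      exact mul_le_mul (le_abs_self C) h5 (by positivity) (abs_nonneg C)
    have h8 : C * ‖A.op x - x‖ ^ 2 ≤ E * ‖x‖ ^ 2 := by
      rw [hE, mul_assoc]
      exact mul_le_mul (le_abs_self C) h6 (by positivity) (abs_nonneg C)
    have h9 : 0 ≤ E * ‖x‖ ^ 2 := by positivity
    have := (abs_le.1 h1).2
    have := (abs_le.1 h2).1
    linarith
  have : √(‖A.cls x‖ ^ 2) ≤ √(E * ‖x‖ ^ 2) := Real.sqrt_le_sqrt key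
  rwa [Real.sqrt_sq (norm_nonneg _), Real.sqrt_mul hE0, Real.sqrt_sq (norm_nonneg _)] at this

lemma A₀lin_symmetric (u v : A.K₀) : inner ℂ (A.A₀lin u) v = inner ℂ u (A.A₀lin v) := by
  obtain ⟨x, rfl⟩ := A.cls_surjective u
  obtain ⟨y, rfl⟩ := A.cls_surjective v
  rw [A₀lin_cls, A₀lin_cls, inner_cls, inner_cls, A.selfadjoint (A.op y) x]

lemma norm_A₀lin_le (u : A.K₀) : ‖A.A₀lin u‖ ≤ ‖A.op‖ * ‖u‖ := by
  obtain ⟨x, rfl⟩ := A.cls_surjective u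
  obtain ⟨D, hD0, hD⟩ := A.exists_norm_cls_le
  set r := ‖A.op‖ with hr
  have hr0 : 0 ≤ r := norm_nonneg _
  set z : ℕ → K := fun n => (A.op)^[n] x with hz
  have hzs : ∀ n, z (n + 1) = A.op (z n) := fun n => Function.iterate_succ_apply' _ _ _
  have hzn : ∀ n, ‖z n‖ ≤ r ^ n * ‖x‖ := by
    intro n
    induction n with
    | zero => simp [hz]
    | succ n ih =>
      rw [hzs, pow_succ']
      calc ‖A.op (z n)‖ ≤ r * ‖z n‖ := A.op.le_opNorm _
        _ ≤ r * (r ^ n * ‖x‖) := by gcongr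
        _ = _ := by ring
  set a : ℕ → ℝ := fun n => ‖A.cls (z n)‖ with ha
  have ha_nn : ∀ n, 0 ≤ a n := fun n => norm_nonneg _
  have haD : ∀ n, a n ≤ D * ‖x‖ * r ^ n := by
    intro n
    calc a n ≤ D * ‖z n‖ := hD _
      _ ≤ D * (r ^ n * ‖x‖) := by gcongr; exact hzn n
      _ = _ := by ring
  have hconv : ∀ n, a (n + 1) ^ 2 ≤ a n * a (n + 2) := by
    intro n
    have h1 : A.cls (z (n + 1)) = A.A₀lin (A.cls (z n)) := by rw [A₀lin_cls, hzs]
    have h2 : A.cls (z (n + 2)) = A.A₀lin (A.cls (z (n + 1))) := by rw [A₀lin_cls, hzs]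
    have h3 : inner ℂ (A.cls (z (n + 1))) (A.cls (z (n + 1)))
        = inner ℂ (A.cls (z n)) (A.cls (z (n + 2))) := by
      nth_rewrite 1 [h1]
      rw [A₀lin_symmetric, ← h2]
    have h4 := @norm_inner_le_norm ℂ _ _ _ _ (A.cls (z n)) (A.cls (z (n + 2)))
    rw [← h3, inner_self_eq_norm_sq_to_K] at h4
    simpa using h4
  have ha1 : ‖A.A₀lin (A.cls x)‖ = a 1 := rfl
  have ha0 : ‖A.cls x‖ = a 0 := rfl
  rw [ha1, ha0]
  by_contra! hlt
  have h1pos : 0 < a 1 := lt_of_le_of_lt (mul_nonneg hr0 (ha_nn 0)) hlt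
  have h0pos : 0 < a 0 := by
    rcases (ha_nn 0).lt_or_eq with h | h
    · exact h
    · have := hconv 0
      rw [← h, zero_mul] at this
      nlinarith
  set s := a 1 / a 0 with hs
  have hspos : 0 < s := div_pos h1pos h0pos
  have hrs : r < s := by rw [hs, lt_div_iff₀ h0pos]; exact hlt
  have hstep : ∀ n, 0 < a n ∧ s * a n ≤ a (n + 1) := by
    intro n
    induction n with
    | zero => exact ⟨h0pos, by rw [hs, div_mul_cancel₀ _ h0pos.ne']⟩
    | succ n ih =>
      have hp : 0 < a (n + 1) := lt_of_lt_of_le (mul_pos hspos ih.1) ih.2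
      refine ⟨hp, ?_⟩
      have h1 := hconv n
      have h2 : a n * (s * a (n + 1)) ≤ a n * a (n + 2) := by nlinarith
      exact le_of_mul_le_mul_left h2 ih.1
  have hlow : ∀ n, a 0 * s ^ n ≤ a n := by
    intro n
    induction n with
    | zero => simp
    | succ n ih =>
      calc a 0 * s ^ (n + 1) = s * (a 0 * s ^ n) := by ring
        _ ≤ s * a n := by gcongr
        _ ≤ _ := (hstep n).2
  have hlim : Tendsto (fun n : ℕ => D * ‖x‖ * (r / s) ^ n) atTop (𝓝 (D * ‖x‖ * 0)) :=
    (tendsto_pow_atTop_nhds_zero_of_lt_one (by positivity)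
      ((div_lt_one hspos).2 hrs)).const_mul _
  have hbd : ∀ n : ℕ, a 0 ≤ D * ‖x‖ * (r / s) ^ n := by
    intro n
    rw [div_pow, ← mul_div_assoc, le_div_iff₀ (pow_pos hspos n)]
    exact (hlow n).trans (haD n)
  have := ge_of_tendsto' hlim hbd
  linarith

/-- The bounded operator `A₀ [x] = [Ax]` on the pre-Hilbert space `K₀`. -/
def A₀ : A.K₀ →L[ℂ] A.K₀ := A.A₀lin.mkContinuous ‖A.op‖ A.norm_A₀lin_le

/-- The Hilbert space completion of `K₀`. -/
abbrev Ktilde : Type _ := UniformSpace.Completion A.K₀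

/-- The bounded selfadjoint extension of `A₀` to the completion. -/
def Atilde : A.Ktilde →L[ℂ] A.Ktilde := A.A₀.completion

lemma Atilde_coe (x : K) : A.Atilde (A.cls x : A.Ktilde) = (A.cls (A.op x) : A.Ktilde) :=
  ContinuousLinearMap.completion_apply_coe _ _

lemma Atilde_isSelfAdjoint : IsSelfAdjoint A.Atilde := by
  rw [ContinuousLinearMap.isSelfAdjoint_iff_isSymmetric]
  intro u v
  simp only [ContinuousLinearMap.coe_coe]
  induction u, v using UniformSpace.Completion.induction_on₂ with
  | hp =>
    exact isClosed_eq
      ((A.Atilde.continuous.comp continuous_fst).inner continuous_snd)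
      (continuous_fst.inner (A.Atilde.continuous.comp continuous_snd))
  | ih u v =>
    obtain ⟨x, rfl⟩ := A.cls_surjective u
    obtain ⟨y, rfl⟩ := A.cls_surjective v
    rw [Atilde_coe, Atilde_coe, UniformSpace.Completion.inner_coe,
      UniformSpace.Completion.inner_coe]
    exact A.A₀lin_symmetric (A.cls x) (A.cls y)

/-- The constant `μ₋`: the supremum of the negative spectrum of `A`, and `-∞` if there is none. -/
def muMinus : EReal := sSup ((fun r : ℝ => (r : EReal)) '' (realSpectrum A.op ∩ Iio 0))

/-- The constant `μ₊`: the infimum of the positive spectrum of `A`, and `+∞` if there is none. -/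
def muPlus : EReal := sInf ((fun r : ℝ => (r : EReal)) '' (realSpectrum A.op ∩ Ioi 0))

/-- Zero is an isolated eigenvalue of `A`: an eigenvalue and an isolated point of the spectrum. -/
def ZeroIsIsolatedEigenvalue : Prop :=
  Module.End.HasEigenvalue (A.op : Module.End ℂ K) 0 ∧
    ∀ᶠ z in 𝓝[≠] (0 : ℂ), z ∉ spectrum ℂ A.op

end BoundedNonneg
end KreinSpace

end

/-! Let `T x = [x]` (`toKtilde`) and let `R` (`fromKtilde`) be the continuous extension of `[x] ↦
Ax` to the completion. Then `A = RT` and `Ã = TR`, so the two spectra agree away from zero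
(`mem_spectrum_Atilde_iff`), and both are real because `Ã` is selfadjoint. Moreover `T` has dense
range and `R`, being its adjoint up to the indefinite form, is injective.

The quotient `[Ax, Ax] / [Ax, x]` is the Rayleigh quotient of `Ã` at `Tx`. By density and
connectedness, the closure of its range is the interval spanned by the spectrum of `Ã`
(`closure_coNumericalRange`).

Everything else reduces to whether zero lies in both spectra. If zero is not an isolated eigenvalue
of `A`, the spectra coincide (`realSpectrum_Atilde_of_not_isolated`). If it is one, zero belongs to
the spectrum of `Ã` exactly when `A` has a Jordan chain of length two at zero
(`zero_mem_realSpectrum_Atilde_iff`). This matters only for an extremum of the spectrum of `A` that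
is itself zero. -/

/-! ### Spectra of the products `RT` and `TR`. -/

/-- The nonzero spectrum does not change when the order of a composition is reversed. -/
lemma isUnit_algebraMap_sub_comp_swap {E F : Type*} [NormedAddCommGroup E] [NormedSpace ℂ E]
    [NormedAddCommGroup F] [NormedSpace ℂ F] (T : E →L[ℂ] F) (R : F →L[ℂ] E) {z : ℂ} (hz : z ≠ 0)
    (h : IsUnit (algebraMap ℂ (F →L[ℂ] F) z - T ∘L R)) :
    IsUnit (algebraMap ℂ (E →L[ℂ] E) z - R ∘L T) := by
  obtain ⟨⟨S, B, h1, h2⟩, rfl : S = _⟩ := h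
  have h1' : ∀ u, z • B u - T (R (B u)) = u := fun u => by
    simpa [Algebra.algebraMap_eq_smul_one] using congrArg (fun f => f u) h1
  have h2' : ∀ u, B (z • u - T (R u)) = u := fun u => by
    simpa [Algebra.algebraMap_eq_smul_one] using congrArg (fun f => f u) h2
  -- With `B = (z - TR)⁻¹`, the inverse of `z - RT` is `z⁻¹ (1 + R B T)`, as the Neumann series
  -- suggests.
  refine ⟨⟨algebraMap ℂ (E →L[ℂ] E) z - R ∘L T, z⁻¹ • (1 + R ∘L B ∘L T), ?_, ?_⟩, rfl⟩
  · ext x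
    have h3 := congrArg R (h1' (T x))
    simp only [map_sub, map_smul] at h3
    have h4 : z • x - R (T x) + (z • R (B (T x)) - R (T (R (B (T x))))) = z • x := by
      rw [h3]; abel
    have h5 : z • (x + R (B (T x))) - R (T (x + R (B (T x)))) = z • x := by
      rw [← h4, smul_add, map_add, map_add]; abel
    simp only [Algebra.algebraMap_eq_smul_one, mul_apply_eq_comp,
      sub_apply, smul_apply,
      one_apply_eq_self, add_apply,
      ContinuousLinearMap.comp_apply, map_smul]
    rw [h5, inv_smul_smul₀ hz]
  · ext x
    have h3 : B (T (z • x - R (T x))) = T x := by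
      rw [map_sub, map_smul, h2']
    simp only [Algebra.algebraMap_eq_smul_one, mul_apply_eq_comp,
      sub_apply, smul_apply,
      one_apply_eq_self, add_apply,
      ContinuousLinearMap.comp_apply]
    rw [h3, sub_add_cancel, inv_smul_smul₀ hz]

lemma mem_spectrum_comp_swap {E F : Type*} [NormedAddCommGroup E] [NormedSpace ℂ E]
    [NormedAddCommGroup F] [NormedSpace ℂ F] (T : E →L[ℂ] F) (R : F →L[ℂ] E) {z : ℂ} (hz : z ≠ 0) :
    z ∈ spectrum ℂ (R ∘L T) ↔ z ∈ spectrum ℂ (T ∘L R) := by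
  rw [spectrum.mem_iff, spectrum.mem_iff, not_iff_not]
  exact ⟨isUnit_algebraMap_sub_comp_swap R T hz, isUnit_algebraMap_sub_comp_swap T R hz⟩

lemma mem_realSpectrum_iff {H : Type*} [NormedAddCommGroup H] [NormedSpace ℂ H]
    {S : H →L[ℂ] H} {r : ℝ} : r ∈ realSpectrum S ↔ r ∈ spectrum ℝ S := by
  rw [realSpectrum, mem_ofPred_eq, spectrum.mem_iff, spectrum.mem_iff,
    Algebra.algebraMap_eq_smul_one, Algebra.algebraMap_eq_smul_one, Complex.coe_smul]

/-! ### Selfadjoint operators in Hilbert space. -/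

section SelfAdjoint

variable {H : Type*} [NormedAddCommGroup H] [InnerProductSpace ℂ H] [CompleteSpace H]
  {S : H →L[ℂ] H}

/-- Both sides say that `S - c` is a positive operator. -/
lemma IsSelfAdjoint.forall_le_realSpectrum_iff (hS : IsSelfAdjoint S) (c : ℝ) :
    (∀ r ∈ realSpectrum S, c ≤ r) ↔ ∀ u, c * ‖u‖ ^ 2 ≤ (inner ℂ (S u) u).re := by
  simp only [mem_realSpectrum_iff]
  rw [← algebraMap_le_iff_le_spectrum hS, ContinuousLinearMap.le_def,
    ContinuousLinearMap.isPositive_def']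
  have hsa : IsSelfAdjoint (S - algebraMap ℝ (H →L[ℂ] H) c) := hS.sub (.algebraMap _ (.all c))
  rw [and_iff_right hsa]
  refine forall_congr' fun u => ?_
  have h : (S - algebraMap ℝ (H →L[ℂ] H) c).reApplyInnerSelf u
      = (inner ℂ (S u) u).re - c * ‖u‖ ^ 2 := by
    simp [ContinuousLinearMap.reApplyInnerSelf_apply, Algebra.algebraMap_eq_smul_one, inner_sub_left,
      inner_self_eq_norm_sq_to_K, inner_smul_left_eq_smul,
      ← Complex.ofReal_pow]
  rw [h, sub_nonneg]

lemma IsSelfAdjoint.forall_realSpectrum_le_iff (hS : IsSelfAdjoint S) (c : ℝ) :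
    (∀ r ∈ realSpectrum S, r ≤ c) ↔ ∀ u, (inner ℂ (S u) u).re ≤ c * ‖u‖ ^ 2 := by
  have h := hS.neg.forall_le_realSpectrum_iff (-c)
  have h1 : ∀ r, r ∈ realSpectrum (-S) ↔ -r ∈ realSpectrum S := fun r => by
    simp [realSpectrum, ← spectrum.neg_eq]
  simp only [h1, neg_apply, inner_neg_left, Complex.neg_re, neg_mul,
    neg_le_neg_iff] at h
  rw [← h]
  exact ⟨fun h r hr => by linarith [h _ hr], fun h r hr => by linarith [h (-r) (by simpa using hr)]⟩

/-- If zero is an isolated point of the spectrum of a selfadjoint operator `S`, then `S` has a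
nonzero kernel projection `E`, and a relative inverse `B` on the complement. -/
lemma IsSelfAdjoint.exists_kernel_projection (hS : IsSelfAdjoint S) (h0 : 0 ∈ realSpectrum S)
    (hiso : ∀ᶠ r in 𝓝[≠] (0 : ℝ), r ∉ realSpectrum S) :
    ∃ E B : H →L[ℂ] H, E ≠ 0 ∧ S * E = 0 ∧ S * B = 1 - E := by
  have h0' : (0 : ℝ) ∈ spectrum ℝ S := mem_realSpectrum_iff.1 h0
  -- Zero is isolated in the spectrum, so continuity there is automatic and the functional calculus
  -- admits functions that jump or blow up at zero.
  have hcont : ∀ f : ℝ → ℝ, ContinuousOn f {0}ᶜ → ContinuousOn f (spectrum ℝ S) := by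
    intro f hf r hr
    by_cases h : r = 0
    · subst h
      have h1 : 𝓝[spectrum ℝ S] (0 : ℝ) ≤ pure 0 := by
        rw [le_pure_iff, mem_nhdsWithin_iff_eventually]
        rw [eventually_nhdsWithin_iff] at hiso
        filter_upwards [hiso] with r hr hrS
        by_contra h
        exact hr h (mem_realSpectrum_iff.2 hrS)
      exact (tendsto_pure_nhds f 0).mono_left h1
    · exact ((hf r h).continuousAt (isOpen_compl_singleton.mem_nhds h)).continuousWithinAt
  have hE : ContinuousOn (fun r : ℝ => if r = 0 then (1 : ℝ) else 0) (spectrum ℝ S) := by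
    refine hcont _ (continuousOn_const (c := (0 : ℝ)).congr fun r hr => if_neg hr)
  have hB : ContinuousOn (fun r : ℝ => r⁻¹) (spectrum ℝ S) := hcont _ continuousOn_inv₀
  have hid : ContinuousOn (fun r : ℝ => r) (spectrum ℝ S) := continuousOn_id
  -- `E` comes from the indicator of zero and `B` from `r⁻¹`. Since `0⁻¹ = 0`, the identity `r * r⁻¹
  -- = 1 - indicator` holds at zero too.
  refine ⟨cfc (fun r : ℝ => if r = 0 then (1 : ℝ) else 0) S, cfc (fun r : ℝ => r⁻¹) S, ?_, ?_, ?_⟩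
  · intro h
    have h1 := cfc_map_spectrum (R := ℝ) (fun r : ℝ => if r = 0 then (1 : ℝ) else 0) S hS hE
    have h2 : (1 : ℝ) ∈ spectrum ℝ (0 : H →L[ℂ] H) := by
      rw [← h, h1]
      exact ⟨0, h0', if_pos rfl⟩
    have : Nontrivial (H →L[ℂ] H) := by
      by_contra hn
      rw [not_nontrivial_iff_subsingleton] at hn
      exact h2 (isUnit_of_subsingleton _)
    rw [spectrum.zero_eq] at h2
    simp at h2
  · nth_rewrite 1 [← cfc_id' ℝ S hS]
    rw [← cfc_mul _ _ S hid hE]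
    have : (fun r : ℝ => r * if r = 0 then (1 : ℝ) else 0) = fun _ => 0 := by
      ext r; split_ifs with h <;> simp [h]
    rw [this, cfc_const_zero]
  · nth_rewrite 1 [← cfc_id' ℝ S hS]
    rw [← cfc_mul _ _ S hid hB, ← cfc_const_one ℝ S hS, ← cfc_sub _ _ S continuousOn_const hE]
    congr 1
    ext r
    by_cases h : r = 0 <;> simp [h]

end SelfAdjoint

/-! ### Completeness and norm of a Krein space. -/

namespace KreinSpace

variable {K : Type*} [NormedAddCommGroup K] [NormedSpace ℂ K]

/-- The decomposition identifies `K` with `P × N`. The two-sided norm estimate, taken also with one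
component zero, bounds each component by the sum, so this identification is a uniform isomorphism.
-/
lemma completeSpace (𝒦 : KreinSpace K) : CompleteSpace K := by
  obtain ⟨P, N, hPN, -, hP, hN, hPc, hNc, c, C, hc, hC⟩ := 𝒦.exists_fundamental_decomposition
  have hP0 : ∀ x ∈ P, 0 ≤ (𝒦.form x x).re := fun x hx => by
    by_cases h : x = 0
    · simp [h]
    · exact (hP x hx h).le
  have hN0 : ∀ x ∈ N, (𝒦.form x x).re ≤ 0 := fun x hx => by
    by_cases h : x = 0
    · simp [h]
    · exact (hN x hx h).le
  have : CompleteSpace P := hPc.completeSpace_coe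
  have : CompleteSpace N := hNc.completeSpace_coe
  let e : (P × N) ≃ₗ[ℂ] K := P.prodEquivOfIsCompl N hPN
  have he : ∀ p, e p = (p.1 : K) + p.2 := fun p => by simp [e]
  have hcont : Continuous e := by
    have : (e : P × N → K) = fun p => (p.1 : K) + p.2 := funext he
    rw [this]
    fun_prop
  have hanti : AntilipschitzWith (Real.toNNReal √(C / c)) e := by
    refine AddMonoidHomClass.antilipschitz_of_bound e fun p => ?_
    rw [he, Real.coe_toNNReal _ (Real.sqrt_nonneg _)]
    have h1 := (hC p.1 p.1.2 p.2 p.2.2).2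
    have h2 := (hC p.1 p.1.2 0 N.zero_mem).1
    have h3 := (hC 0 P.zero_mem p.2 p.2.2).1
    have h4 := hP0 p.1 p.1.2
    have h5 := hN0 p.2 p.2.2
    simp only [add_zero, zero_add, map_zero, Complex.zero_re, sub_zero, zero_sub] at h2 h3
    have key : ∀ y : K, c * ‖y‖ ^ 2 ≤ C * ‖(p.1 : K) + p.2‖ ^ 2 →
        ‖y‖ ≤ √(C / c) * ‖(p.1 : K) + p.2‖ := by
      intro y hy
      rw [← Real.sqrt_sq (norm_nonneg y), ← Real.sqrt_sq (norm_nonneg ((p.1 : K) + p.2)),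
        ← Real.sqrt_mul' _ (by positivity)]
      apply Real.sqrt_le_sqrt
      rw [div_mul_eq_mul_div, le_div_iff₀ hc]
      linarith
    rw [Prod.norm_def]
    exact max_le (key p.1 (by linarith)) (key p.2 (by linarith))
  have huc : UniformContinuous e := by
    exact uniformContinuous_addMonoidHom_of_continuous (f := e.toLinearMap.toAddMonoidHom) hcont
  exact (completeSpace_congr (e := e.toEquiv) (hanti.isUniformEmbedding huc)).1 inferInstance

/-- The Krein space form determines the norm: `‖z‖` is bounded by the values `[z, y]`. -/
lemma exists_norm_le_of_form_le (𝒦 : KreinSpace K) :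
    ∃ D : ℝ, 0 ≤ D ∧ ∀ (z : K) (M : ℝ), 0 ≤ M → (∀ y, ‖𝒦.form z y‖ ≤ M * ‖y‖) → ‖z‖ ≤ D * M := by
  obtain ⟨P, N, hPN, hort, hP, hN, -, -, c, C, hc, hC⟩ := 𝒦.exists_fundamental_decomposition
  refine ⟨√(|C| / c) / c, by positivity, fun z M hM h => ?_⟩
  obtain ⟨x, hx, y, hy, rfl⟩ := Submodule.mem_sup.1
    (hPN.sup_eq_top ▸ Submodule.mem_top : z ∈ P ⊔ N)
  have h1 : 𝒦.form x y = 0 := hort x hx y hy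
  have h2 : 𝒦.form y x = 0 := by rw [𝒦.hermitian, h1, map_zero]
  have h3 := hC x hx y hy
  have h4 := (hC x hx (-y) (N.neg_mem hy)).1
  simp only [map_neg, LinearMap.neg_apply, neg_neg] at h4
  -- The test vector is the image `x - y` of `z = x + y` under the fundamental symmetry: pairing it
  -- with `z` gives the squared Hilbert norm of `z`.
  have h5 : 𝒦.form (x + y) (x + -y) = 𝒦.form x x - 𝒦.form y y := by simp [h1, h2]; ring
  have h6 := (Complex.re_le_norm _).trans (h (x + -y))
  rw [h5, Complex.sub_re] at h6
  have h7 : ‖x + -y‖ ≤ √(|C| / c) * ‖x + y‖ := by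
    rw [← Real.sqrt_sq (norm_nonneg (x + -y)), ← Real.sqrt_sq (norm_nonneg (x + y)),
      ← Real.sqrt_mul' _ (by positivity)]
    apply Real.sqrt_le_sqrt
    rw [div_mul_eq_mul_div, le_div_iff₀ hc]
    have : C * ‖x + y‖ ^ 2 ≤ |C| * ‖x + y‖ ^ 2 := by gcongr; exact le_abs_self C
    linarith
  have h8 : c * ‖x + y‖ * ‖x + y‖ ≤ M * √(|C| / c) * ‖x + y‖ := by
    have : M * ‖x + -y‖ ≤ M * (√(|C| / c) * ‖x + y‖) := by gcongr
    nlinarith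
  rcases (norm_nonneg (x + y)).eq_or_lt with h9 | h9
  · rw [← h9]; positivity
  · have := le_of_mul_le_mul_right h8 h9
    rw [div_mul_eq_mul_div, le_div_iff₀ hc]
    linarith

end KreinSpace

/-! ### Factorization of `A` and `Ã` through each other's space. -/

namespace KreinSpace.BoundedNonneg

variable {K : Type*} [NormedAddCommGroup K] [NormedSpace ℂ K] {𝒦 : KreinSpace K}
  (A : 𝒦.BoundedNonneg)

/-- The bounded operator `x ↦ [x]` from the Krein space to the completion. -/
noncomputable def toKtilde : K →L[ℂ] A.Ktilde :=
  UniformSpace.Completion.toComplL ∘L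
    A.cls.mkContinuousOfExistsBound (A.exists_norm_cls_le.imp fun _ h => h.2)

lemma toKtilde_apply (x : K) : A.toKtilde x = (A.cls x : A.Ktilde) := rfl

lemma norm_toKtilde_sq (x : K) : ‖A.toKtilde x‖ ^ 2 = (𝒦.form (A.op x) x).re := by
  rw [toKtilde_apply, UniformSpace.Completion.norm_coe, norm_cls_sq]

lemma inner_toKtilde (x y : K) :
    inner ℂ (A.toKtilde x) (A.toKtilde y) = 𝒦.form (A.op y) x := by
  rw [toKtilde_apply, toKtilde_apply, UniformSpace.Completion.inner_coe, inner_cls]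

lemma denseRange_toKtilde : DenseRange A.toKtilde :=
  UniformSpace.Completion.denseRange_coe.comp A.cls_surjective.denseRange
    (UniformSpace.Completion.continuous_coe _)

lemma Atilde_toKtilde (x : K) : A.Atilde (A.toKtilde x) = A.toKtilde (A.op x) := A.Atilde_coe x

lemma toKtilde_eq_zero_iff {x : K} : A.toKtilde x = 0 ↔ A.op x = 0 := by
  rw [toKtilde_apply, UniformSpace.Completion.coe_eq_zero_iff, ← map_zero A.cls, cls_eq_cls,
    map_zero]

/-- Since `[Ax, y]` is an inner product of classes, Cauchy–Schwarz bounds it by the seminorm of `x`,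
and the form controls the norm of `Ax`. This is what allows `[x] ↦ Ax` to extend to the completion.
-/
lemma exists_norm_op_le : ∃ C : ℝ, ∀ x, ‖A.op x‖ ≤ C * ‖A.toKtilde x‖ := by
  obtain ⟨D, hD, h⟩ := 𝒦.exists_norm_le_of_form_le
  refine ⟨D * ‖A.toKtilde‖, fun x => ?_⟩
  rw [mul_assoc]
  refine h _ _ (by positivity) fun y => ?_
  rw [← inner_toKtilde]
  calc _ ≤ ‖A.toKtilde y‖ * ‖A.toKtilde x‖ := norm_inner_le_norm _ _
    _ ≤ (‖A.toKtilde‖ * ‖y‖) * ‖A.toKtilde x‖ := by gcongr; exact A.toKtilde.le_opNorm y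
    _ = _ := by ring

/-- The bounded operator from the completion to the Krein space with `[x] ↦ Ax`. -/
noncomputable def fromKtilde : A.Ktilde →L[ℂ] K :=
  have := 𝒦.completeSpace
  A.op.toLinearMap.extendOfNorm A.toKtilde.toLinearMap

lemma fromKtilde_toKtilde (x : K) : A.fromKtilde (A.toKtilde x) = A.op x :=
  have := 𝒦.completeSpace
  LinearMap.extendOfNorm_eq A.denseRange_toKtilde A.exists_norm_op_le x

lemma op_eq_comp : A.op = A.fromKtilde ∘L A.toKtilde :=
  ContinuousLinearMap.ext fun x => (A.fromKtilde_toKtilde x).symm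

lemma toKtilde_fromKtilde (u : A.Ktilde) : A.toKtilde (A.fromKtilde u) = A.Atilde u := by
  refine congrFun (A.denseRange_toKtilde.equalizer (A.toKtilde ∘L A.fromKtilde).continuous
    A.Atilde.continuous (funext fun x => ?_)) u
  simp only [Function.comp_apply, ContinuousLinearMap.comp_apply]
  rw [fromKtilde_toKtilde, Atilde_toKtilde]

lemma Atilde_eq_comp : A.Atilde = A.toKtilde ∘L A.fromKtilde :=
  ContinuousLinearMap.ext fun u => (A.toKtilde_fromKtilde u).symm

/-- Polarization turns the bound on `[z, z]` into a bound on the real part of `[z, y]` for `z` in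
the unit ball; replacing `z` by `iz` handles the imaginary part. -/
lemma continuous_form_left (𝒦 : KreinSpace K) (y : K) : Continuous fun x => 𝒦.form x y := by
  obtain ⟨C, hC⟩ := exists_abs_form_le 𝒦
  have hre : ∀ z, ‖z‖ ≤ 1 → |(𝒦.form z y).re| ≤ |C| * (1 + ‖y‖) ^ 2 := by
    intro z hz
    have h1 : (𝒦.form (z + y) (z + y)).re - (𝒦.form (z - y) (z - y)).re
        = 4 * (𝒦.form z y).re := by
      have : (𝒦.form y z).re = (𝒦.form z y).re := by rw [𝒦.hermitian, Complex.conj_re]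
      simp only [map_add, map_sub, LinearMap.add_apply, LinearMap.sub_apply, Complex.add_re,
        Complex.sub_re, this]
      ring
    have h2 : ∀ w : K, ‖w‖ ≤ 1 + ‖y‖ → |(𝒦.form w w).re| ≤ |C| * (1 + ‖y‖) ^ 2 := fun w hw =>
      (hC w).trans (by gcongr; exact le_abs_self C)
    have h3 := abs_le.1 (h2 (z + y) ((norm_add_le _ _).trans (by gcongr)))
    have h4 := abs_le.1 (h2 (z - y) ((norm_sub_le _ _).trans (by gcongr)))
    have h5 : 0 ≤ |C| * (1 + ‖y‖) ^ 2 := by positivity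
    rw [abs_le]
    constructor <;> linarith [h3.1, h3.2, h4.1, h4.2]
  have hbd : ∀ z ∈ Metric.closedBall (0 : K) 1,
      ‖𝒦.form.flip y z‖ ≤ 2 * (|C| * (1 + ‖y‖) ^ 2) := by
    intro z hz
    rw [mem_closedBall_zero_iff] at hz
    have h1 := hre z hz
    have h2 := hre (Complex.I • z) (by simpa [norm_smul] using hz)
    have h3 : (𝒦.form (Complex.I • z) y).re = -(𝒦.form z y).im := by simp
    rw [h3, abs_neg] at h2
    rw [LinearMap.flip_apply]
    linarith [Complex.norm_le_abs_re_add_abs_im (𝒦.form z y)]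
  exact AddMonoidHomClass.continuous_of_bound (𝒦.form.flip y) _
    (LinearMap.bound_of_ball_bound' one_pos _ (𝒦.form.flip y) hbd)

/-- `R` is adjoint to `T`: the inner product of `v` with `Tx` is the conjugate of `[Rv, x]`. A
kernel vector of `R` is therefore orthogonal to the dense range of `T`. -/
lemma fromKtilde_injective : Function.Injective A.fromKtilde := by
  rw [injective_iff_map_eq_zero]
  intro u hu
  have h1 : ∀ x, inner ℂ u (A.toKtilde x) = (0 : ℂ) := by
    intro x
    have h : ∀ v, inner ℂ v (A.toKtilde x) = conj (𝒦.form (A.fromKtilde v) x) := fun v => by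
      refine A.denseRange_toKtilde.induction_on v (isClosed_eq (by fun_prop)
        (Complex.continuous_conj.comp
          ((continuous_form_left 𝒦 x).comp A.fromKtilde.continuous))) fun y => ?_
      rw [inner_toKtilde, fromKtilde_toKtilde, ← 𝒦.hermitian, A.selfadjoint]
    rw [h, hu, map_zero, LinearMap.zero_apply, map_zero]
  have h2 : inner ℂ u u = (0 : ℂ) := by
    exact A.denseRange_toKtilde.induction_on u (p := fun v => inner ℂ u v = (0 : ℂ))
      (isClosed_eq (by fun_prop) continuous_const) h1
  exact inner_self_eq_zero.1 h2

/-! ### Comparison of the spectra of `A` and `Ã`. -/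

lemma mem_spectrum_Atilde_iff {z : ℂ} (hz : z ≠ 0) :
    z ∈ spectrum ℂ A.Atilde ↔ z ∈ spectrum ℂ A.op := by
  rw [A.Atilde_eq_comp, A.op_eq_comp]
  exact mem_spectrum_comp_swap _ _ hz

lemma im_eq_zero_of_mem_spectrum_Atilde {z : ℂ} (hz : z ∈ spectrum ℂ A.Atilde) : z.im = 0 :=
  A.Atilde_isSelfAdjoint.im_eq_zero_of_mem_spectrum hz

lemma im_eq_zero_of_mem_spectrum_op {z : ℂ} (hz : z ∈ spectrum ℂ A.op) : z.im = 0 := by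
  by_cases h : z = 0
  · simp [h]
  · exact A.im_eq_zero_of_mem_spectrum_Atilde ((A.mem_spectrum_Atilde_iff h).2 hz)

lemma mem_realSpectrum_Atilde_iff {r : ℝ} (hr : r ≠ 0) :
    r ∈ realSpectrum A.Atilde ↔ r ∈ realSpectrum A.op :=
  A.mem_spectrum_Atilde_iff (by simpa using hr)

lemma zero_mem_realSpectrum_iff {E : Type*} [NormedAddCommGroup E] [NormedSpace ℂ E]
    {S : E →L[ℂ] E} : 0 ∈ realSpectrum S ↔ ¬ IsUnit S := by
  simp [realSpectrum, spectrum.zero_mem_iff]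

lemma toKtilde_injective (h : Function.Injective A.op) : Function.Injective A.toKtilde := by
  rw [injective_iff_map_eq_zero]
  exact fun x hx => h (by rw [map_zero, ← toKtilde_eq_zero_iff, hx])

lemma isUnit_Atilde_of_isUnit_op (h : IsUnit A.op) : IsUnit A.Atilde := by
  obtain ⟨⟨a, B, h1, h2⟩, rfl : a = A.op⟩ := h
  have h1' : ∀ x, A.op (B x) = x := fun x => congrArg (fun f => f x) h1
  have h2' : ∀ x, B (A.op x) = x := fun x => congrArg (fun f => f x) h2
  -- With `B = A⁻¹`, `TBR` is the identity on the dense range of `T`, since `TBRT = TBA = T`. Hence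
  -- `T B² R` inverts `TR`.
  have h3 : ∀ u, A.toKtilde (B (A.fromKtilde u)) = u := fun u => by
    refine congrFun (A.denseRange_toKtilde.equalizer
      (A.toKtilde ∘L B ∘L A.fromKtilde).continuous continuous_id (funext fun x => ?_)) u
    simp [fromKtilde_toKtilde, h2']
  refine ⟨⟨A.Atilde, A.toKtilde ∘L B ∘L B ∘L A.fromKtilde, ?_, ?_⟩, rfl⟩
  · ext u
    simp [Atilde_toKtilde, h1', h3]
  · ext u
    simp [← toKtilde_fromKtilde, fromKtilde_toKtilde, h2', h3]

lemma isUnit_op_of_isUnit_Atilde (hA : Function.Injective A.op) (h : IsUnit A.Atilde) :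
    IsUnit A.op := by
  obtain ⟨⟨a, B, h1, h2⟩, rfl : a = A.Atilde⟩ := h
  have h1' : ∀ x, A.toKtilde (A.fromKtilde (B x)) = x := fun x => by
    rw [toKtilde_fromKtilde]; exact congrArg (fun f => f x) h1
  have h2' : ∀ x, B (A.toKtilde (A.fromKtilde x)) = x := fun x => by
    rw [toKtilde_fromKtilde]; exact congrArg (fun f => f x) h2
  -- Here `B = Ã⁻¹`, and `TRBT = T` gives `RBT = 1` only because `T` is injective, which is where
  -- injectivity of `A` enters.
  have h3 : ∀ x, A.fromKtilde (B (A.toKtilde x)) = x := fun x =>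
    A.toKtilde_injective hA (h1' _)
  refine ⟨⟨A.op, A.fromKtilde ∘L B ∘L B ∘L A.toKtilde, ?_, ?_⟩, rfl⟩
  · ext x
    simp [← fromKtilde_toKtilde, h1', h3]
  · ext x
    simp [← fromKtilde_toKtilde, h2', h3]

lemma ker_op_eq_ker_op_comp_op_of_isUnit (h : IsUnit A.Atilde) :
    A.op.ker = (A.op ∘L A.op).ker := by
  ext x
  simp only [LinearMap.mem_ker, ContinuousLinearMap.coe_coe, ContinuousLinearMap.comp_apply]
  refine ⟨fun hx => by rw [hx, map_zero], fun hx => ?_⟩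
  have h1 : A.Atilde (A.toKtilde x) = 0 := by
    rw [Atilde_toKtilde, toKtilde_eq_zero_iff, hx]
  obtain ⟨⟨a, B, -, h2⟩, rfl : a = A.Atilde⟩ := h
  have h3 : B (A.Atilde (A.toKtilde x)) = A.toKtilde x := congrArg (fun f => f (A.toKtilde x)) h2
  rw [← toKtilde_eq_zero_iff, ← h3, h1, map_zero]

lemma zeroIsIsolatedEigenvalue_iff : A.ZeroIsIsolatedEigenvalue ↔
    ¬ Function.Injective A.op ∧ ∀ᶠ r in 𝓝[≠] (0 : ℝ), r ∉ realSpectrum A.op := by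
  refine and_congr ?_ ?_
  · rw [Module.End.hasEigenvalue_iff, Module.End.eigenspace_zero, ne_eq, LinearMap.ker_eq_bot]
    rfl
  · rw [eventually_nhdsWithin_iff, eventually_nhdsWithin_iff, Metric.eventually_nhds_iff,
      Metric.eventually_nhds_iff]
    refine exists_congr fun ε => and_congr_right fun _ => ⟨fun h r hr hr0 => ?_,
      fun h z hz hz0 hzA => ?_⟩
    · exact h (y := (r : ℂ)) (by simpa using hr) (by simpa using hr0)
    · have h1 : ((z.re : ℝ) : ℂ) = z := Complex.ext rfl (A.im_eq_zero_of_mem_spectrum_op hzA).symm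
      rw [← h1] at hz hz0 hzA
      exact h (by simpa using hz) (by simpa using hz0) hzA

lemma zero_mem_realSpectrum_op_of_not_injective (h : ¬ Function.Injective A.op) :
    0 ∈ realSpectrum A.op := by
  rw [zero_mem_realSpectrum_iff]
  rintro ⟨⟨a, B, -, h2⟩, rfl : a = A.op⟩
  exact h (Function.LeftInverse.injective (g := B) fun x => congrArg (fun f => f x) h2)

lemma realSpectrum_isCompact {E : Type*} [NormedAddCommGroup E] [NormedSpace ℂ E] [CompleteSpace E]
    (S : E →L[ℂ] E) : IsCompact (realSpectrum S) :=
  Complex.isometry_ofReal.isClosedEmbedding.isCompact_preimage (spectrum.isCompact S)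

/-- If `Ã` were invertible, a neighbourhood of zero would miss its spectrum, so zero would be
isolated for `A`. Then `A` could not be injective, since it would be invertible along with `Ã`; so
zero would be an isolated eigenvalue. -/
lemma zero_mem_realSpectrum_Atilde_of_not_isolated (h : ¬ A.ZeroIsIsolatedEigenvalue)
    (h0 : 0 ∈ realSpectrum A.op) : 0 ∈ realSpectrum A.Atilde := by
  contrapose! h
  have h1 : ∀ᶠ r in 𝓝 (0 : ℝ), r ∉ realSpectrum A.Atilde :=
    (realSpectrum_isCompact A.Atilde).isClosed.isOpen_compl.mem_nhds h
  rw [zeroIsIsolatedEigenvalue_iff]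
  constructor
  · intro hi
    rw [zero_mem_realSpectrum_iff, not_not] at h
    exact zero_mem_realSpectrum_iff.1 h0 (A.isUnit_op_of_isUnit_Atilde hi h)
  · filter_upwards [h1.filter_mono nhdsWithin_le_nhds, self_mem_nhdsWithin] with r hr hr0
    rwa [← A.mem_realSpectrum_Atilde_iff hr0]

lemma realSpectrum_Atilde_of_not_isolated (h : ¬ A.ZeroIsIsolatedEigenvalue) :
    realSpectrum A.Atilde = realSpectrum A.op := by
  ext r
  by_cases hr : r = 0
  · subst hr
    refine ⟨fun h1 => ?_, A.zero_mem_realSpectrum_Atilde_of_not_isolated h⟩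
    rw [zero_mem_realSpectrum_iff] at h1 ⊢
    exact mt A.isUnit_Atilde_of_isUnit_op h1
  · exact A.mem_realSpectrum_Atilde_iff hr

lemma zero_mem_realSpectrum_Atilde_iff (h : A.ZeroIsIsolatedEigenvalue) :
    0 ∈ realSpectrum A.Atilde ↔ A.op.ker ≠ (A.op ∘L A.op).ker := by
  refine ⟨fun h0 => ?_, fun hk => ?_⟩
  · have hiso : ∀ᶠ r in 𝓝[≠] (0 : ℝ), r ∉ realSpectrum A.Atilde := by
      filter_upwards [(A.zeroIsIsolatedEigenvalue_iff.1 h).2, self_mem_nhdsWithin] with r hr hr0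
      rwa [A.mem_realSpectrum_Atilde_iff hr0]
    obtain ⟨E, B, hE, hSE, hSB⟩ := A.Atilde_isSelfAdjoint.exists_kernel_projection h0 hiso
    have hSE' : ∀ u, A.Atilde (E u) = 0 := fun u => congrArg (fun f => f u) hSE
    have hSB' : ∀ u, A.Atilde (B u) = u - E u := fun u => congrArg (fun f => f u) hSB
    intro hk
    apply hE
    -- The vector `x = y - RBTy` satisfies `Ax = RETy` and `A²x = RÃETy = 0`. If the kernels agree,
    -- `RETy = 0`, and injectivity of `R` with density of the range of `T` forces `E = 0`.
    have hop : ∀ y, A.op (y - A.fromKtilde (B (A.toKtilde y))) = A.fromKtilde (E (A.toKtilde y)) := by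
      intro y
      rw [map_sub, ← fromKtilde_toKtilde, ← fromKtilde_toKtilde, toKtilde_fromKtilde, hSB', map_sub,
        sub_sub_cancel]
    have hE0 : ∀ y, E (A.toKtilde y) = 0 := by
      intro y
      apply A.fromKtilde_injective
      rw [map_zero, ← hop]
      change _ ∈ A.op.ker
      rw [hk]
      change A.op (A.op _) = 0
      rw [hop, ← fromKtilde_toKtilde, toKtilde_fromKtilde, hSE', map_zero]
    ext u
    exact A.denseRange_toKtilde.induction_on u (p := fun v => E v = 0)
      (isClosed_eq E.continuous continuous_const) hE0
  · rw [zero_mem_realSpectrum_iff]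
    exact mt A.ker_op_eq_ker_op_comp_op_of_isUnit hk

lemma realSpectrum_op_nonempty (h : A.op ≠ 0) : (realSpectrum A.op).Nonempty := by
  have := 𝒦.completeSpace
  obtain ⟨x, hx⟩ := DFunLike.ne_iff.1 h
  have : Nontrivial K := ⟨⟨_, _, hx⟩⟩
  obtain ⟨z, hz⟩ := spectrum.nonempty A.op
  have h1 : ((z.re : ℝ) : ℂ) = z := Complex.ext rfl (A.im_eq_zero_of_mem_spectrum_op hz).symm
  exact ⟨z.re, by rwa [← h1] at hz⟩

lemma realSpectrum_Atilde_nonempty (h : A.op ≠ 0) : (realSpectrum A.Atilde).Nonempty := by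
  obtain ⟨x, hx⟩ := DFunLike.ne_iff.1 h
  have : Nontrivial A.Ktilde := ⟨⟨_, _, mt A.toKtilde_eq_zero_iff.1 hx⟩⟩
  obtain ⟨z, hz⟩ := spectrum.nonempty A.Atilde
  have h1 : ((z.re : ℝ) : ℂ) = z := Complex.ext rfl (A.im_eq_zero_of_mem_spectrum_Atilde hz).symm
  exact ⟨z.re, by rwa [← h1] at hz⟩

/-! ### The co-numerical range as a set of Rayleigh quotients. -/

/-- The quotient `[Ax, Ax] / [Ax, x]` is the Rayleigh quotient of `A₀` at `[x]`. -/
lemma mem_coNumericalRange_iff {r : ℝ} : r ∈ A.coNumericalRange ↔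
    ∃ x, A.toKtilde x ≠ 0 ∧
      r = (inner ℂ (A.Atilde (A.toKtilde x)) (A.toKtilde x)).re / ‖A.toKtilde x‖ ^ 2 := by
  refine exists_congr fun x => ?_
  rw [ne_eq, ne_eq, toKtilde_eq_zero_iff]
  refine and_congr_right fun _ => ?_
  rw [Atilde_toKtilde, inner_toKtilde, norm_toKtilde_sq]
  have h1 : ((𝒦.form (A.op x) (A.op x)).re : ℂ) = 𝒦.form (A.op x) (A.op x) :=
    Complex.conj_eq_iff_re.1 (𝒦.hermitian _ _).symm
  have h2 : ((𝒦.form (A.op x) x).re : ℂ) = 𝒦.form (A.op x) x :=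
    Complex.conj_eq_iff_re.1 (by rw [← 𝒦.hermitian, A.selfadjoint])
  rw [← h1, ← h2, ← Complex.ofReal_div, Complex.ofReal_inj]
  simp

lemma coNumericalRange_eq_image : A.coNumericalRange =
    (fun u : A.K₀ => (inner ℂ (A.A₀ u) u).re / ‖u‖ ^ 2) '' {0}ᶜ := by
  ext r
  rw [mem_coNumericalRange_iff]
  constructor
  · rintro ⟨x, hx, rfl⟩
    refine ⟨A.cls x, fun h => hx ?_, ?_⟩
    · rw [toKtilde_apply, h, UniformSpace.Completion.coe_zero]
    · rw [Atilde_toKtilde, toKtilde_apply, toKtilde_apply, UniformSpace.Completion.inner_coe,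
        UniformSpace.Completion.norm_coe]
      rfl
  · rintro ⟨u, hu, rfl⟩
    obtain ⟨x, rfl⟩ := A.cls_surjective u
    refine ⟨x, fun h => hu ?_, ?_⟩
    · rwa [toKtilde_apply, UniformSpace.Completion.coe_eq_zero_iff] at h
    · rw [Atilde_toKtilde, toKtilde_apply, toKtilde_apply, UniformSpace.Completion.inner_coe,
        UniformSpace.Completion.norm_coe]
      rfl

/-- A nonzero complex space has real dimension at least two, so it stays connected without the
origin, where the Rayleigh quotient is continuous. -/
lemma isPreconnected_coNumericalRange : IsPreconnected A.coNumericalRange := by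
  rw [coNumericalRange_eq_image]
  by_cases h : Subsingleton A.K₀
  · have : ({0}ᶜ : Set A.K₀) = ∅ := by
      ext u; simp [Subsingleton.elim u 0]
    simp [this, isPreconnected_empty]
  rw [not_subsingleton_iff_nontrivial] at h
  have hrank : 1 < Module.rank ℝ A.K₀ := by
    have h1 : 1 ≤ Module.rank ℂ A.K₀ := Cardinal.one_le_iff_ne_zero.2 rank_pos.ne'
    rw [rank_real_of_complex]
    calc (1 : Cardinal) < 2 * 1 := by simp
      _ ≤ _ := by gcongr
  refine (isConnected_compl_singleton_of_one_lt_rank hrank 0).isPreconnected.image _ ?_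
  refine ContinuousOn.div (by fun_prop) (by fun_prop) fun u hu => ?_
  simpa using hu

lemma coNumericalRange_nonempty (h : A.op ≠ 0) : A.coNumericalRange.Nonempty := by
  obtain ⟨x, hx⟩ := DFunLike.ne_iff.1 h
  exact ⟨_, A.mem_coNumericalRange_iff.2 ⟨x, mt A.toKtilde_eq_zero_iff.1 hx, rfl⟩⟩

/-- A quadratic form inequality for `Ã` needs checking only on the dense range of `T`. -/
lemma forall_le_coNumericalRange_iff (c : ℝ) :
    (∀ r ∈ A.coNumericalRange, c ≤ r) ↔ ∀ r ∈ realSpectrum A.Atilde, c ≤ r := by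
  rw [A.Atilde_isSelfAdjoint.forall_le_realSpectrum_iff]
  constructor
  · intro h u
    refine A.denseRange_toKtilde.induction_on u (isClosed_le (by fun_prop) (by fun_prop)) fun x => ?_
    by_cases hx : A.toKtilde x = 0
    · simp [hx]
    · have := h _ (A.mem_coNumericalRange_iff.2 ⟨x, hx, rfl⟩)
      rwa [le_div_iff₀ (by positivity)] at this
  · intro h r hr
    obtain ⟨x, hx, rfl⟩ := A.mem_coNumericalRange_iff.1 hr
    rw [le_div_iff₀ (by positivity)]
    exact h _

lemma forall_coNumericalRange_le_iff (c : ℝ) :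
    (∀ r ∈ A.coNumericalRange, r ≤ c) ↔ ∀ r ∈ realSpectrum A.Atilde, r ≤ c := by
  rw [A.Atilde_isSelfAdjoint.forall_realSpectrum_le_iff]
  constructor
  · intro h u
    refine A.denseRange_toKtilde.induction_on u (isClosed_le (by fun_prop) (by fun_prop)) fun x => ?_
    by_cases hx : A.toKtilde x = 0
    · simp [hx]
    · have := h _ (A.mem_coNumericalRange_iff.2 ⟨x, hx, rfl⟩)
      rwa [div_le_iff₀ (by positivity)] at this
  · intro h r hr
    obtain ⟨x, hx, rfl⟩ := A.mem_coNumericalRange_iff.1 hr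
    rw [div_le_iff₀ (by positivity)]
    exact h _

lemma closure_coNumericalRange (h : A.op ≠ 0) {a b : ℝ} (ha : IsLeast (realSpectrum A.Atilde) a)
    (hb : IsGreatest (realSpectrum A.Atilde) b) : closure A.coNumericalRange = Icc a b := by
  have hne := A.coNumericalRange_nonempty h
  have hglb : IsGLB A.coNumericalRange a :=
    ⟨(A.forall_le_coNumericalRange_iff a).2 fun r hr => ha.2 hr,
      fun c hc => (A.forall_le_coNumericalRange_iff c).1 hc a ha.1⟩
  have hlub : IsLUB A.coNumericalRange b :=
    ⟨(A.forall_coNumericalRange_le_iff b).2 fun r hr => hb.2 hr,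
      fun c hc => (A.forall_coNumericalRange_le_iff c).1 hc b hb.1⟩
  refine subset_antisymm (closure_minimal (fun r hr => ⟨hglb.1 hr, hlub.1 hr⟩) isClosed_Icc) ?_
  exact A.isPreconnected_coNumericalRange.closure.Icc_subset (hglb.mem_closure hne)
    (hlub.mem_closure hne)

/-! ### Comparison of the extrema of the two spectra. -/

-- A negative minimum is a nonzero spectral point, so it transfers between the operators in both
-- directions.
variable {A} in
lemma isLeast_realSpectrum_eq {a a' : ℝ} (ha : IsLeast (realSpectrum A.op) a)
    (ha' : IsLeast (realSpectrum A.Atilde) a') (h : (realSpectrum A.op ∩ Iio 0).Nonempty) :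
    a' = a := by
  obtain ⟨r, hr, hr0 : r < 0⟩ := h
  have h1 : a < 0 := (ha.2 hr).trans_lt hr0
  have h2 : a' ≤ a := ha'.2 ((A.mem_realSpectrum_Atilde_iff h1.ne).2 ha.1)
  exact h2.antisymm (ha.2 ((A.mem_realSpectrum_Atilde_iff (h2.trans_lt h1).ne).1 ha'.1))

variable {A} in
lemma isGreatest_realSpectrum_eq {b b' : ℝ} (hb : IsGreatest (realSpectrum A.op) b)
    (hb' : IsGreatest (realSpectrum A.Atilde) b') (h : (realSpectrum A.op ∩ Ioi 0).Nonempty) :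
    b' = b := by
  obtain ⟨r, hr, hr0 : 0 < r⟩ := h
  have h1 : 0 < b := hr0.trans_le (hb.2 hr)
  have h2 : b ≤ b' := hb'.2 ((A.mem_realSpectrum_Atilde_iff h1.ne').2 hb.1)
  exact (hb.2 ((A.mem_realSpectrum_Atilde_iff (h1.trans_le h2).ne').1 hb'.1)).antisymm h2

-- Here `b = 0`, and `b' = 0` exactly when zero survives in the spectrum of `Ã`, which the kernel
-- criterion decides. Otherwise `b'` is the largest negative spectral point, common to both
-- operators.
variable {A} in
lemma isGreatest_realSpectrum_of_nonpos {b b' : ℝ} (hb : IsGreatest (realSpectrum A.op) b)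
    (hb' : IsGreatest (realSpectrum A.Atilde) b') (h0 : A.ZeroIsIsolatedEigenvalue)
    (h : realSpectrum A.op ∩ Ioi 0 = ∅) :
    (b' = b ↔ A.op.ker ≠ (A.op ∘L A.op).ker) ∧
      (A.op.ker = (A.op ∘L A.op).ker → (b' : EReal) = A.muMinus ∧ A.muMinus < 0) := by
  have hle : ∀ r ∈ realSpectrum A.op, r ≤ 0 := fun r hr =>
    not_lt.1 fun hr0 => (h ▸ ⟨hr, hr0⟩ : r ∈ (∅ : Set ℝ))
  have h1 := A.zero_mem_realSpectrum_op_of_not_injective (A.zeroIsIsolatedEigenvalue_iff.1 h0).1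
  obtain rfl : b = 0 := (hle b hb.1).antisymm (hb.2 h1)
  have hb'0 : b' ≤ 0 := by
    by_contra! hpos
    exact hpos.not_ge (hle b' ((A.mem_realSpectrum_Atilde_iff hpos.ne').1 hb'.1))
  rw [← A.zero_mem_realSpectrum_Atilde_iff h0]
  refine ⟨⟨fun h => h ▸ hb'.1, fun h => hb'0.antisymm (hb'.2 h)⟩, fun hk => ?_⟩
  have hne : b' ≠ 0 := fun h => (A.zero_mem_realSpectrum_Atilde_iff h0).1 (h ▸ hb'.1) hk
  have hlt : b' < 0 := hb'0.lt_of_ne hne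
  have hmu : (b' : EReal) = A.muMinus := by
    have hg : IsGreatest ((fun r : ℝ => (r : EReal)) '' (realSpectrum A.op ∩ Iio 0)) b' := by
      refine ⟨⟨b', ⟨(A.mem_realSpectrum_Atilde_iff hne).1 hb'.1, hlt⟩, rfl⟩, ?_⟩
      rintro _ ⟨r, ⟨hr, hr0 : r < 0⟩, rfl⟩
      exact EReal.coe_le_coe_iff.2 (hb'.2 ((A.mem_realSpectrum_Atilde_iff hr0.ne).2 hr))
    exact hg.isLUB.sSup_eq.symm
  exact ⟨hmu, hmu ▸ EReal.coe_neg'.2 hlt⟩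

variable {A} in
lemma isLeast_realSpectrum_of_nonneg {a a' : ℝ} (ha : IsLeast (realSpectrum A.op) a)
    (ha' : IsLeast (realSpectrum A.Atilde) a') (h0 : A.ZeroIsIsolatedEigenvalue)
    (h : realSpectrum A.op ∩ Iio 0 = ∅) :
    (a' = a ↔ A.op.ker ≠ (A.op ∘L A.op).ker) ∧
      (A.op.ker = (A.op ∘L A.op).ker → (a' : EReal) = A.muPlus ∧ 0 < A.muPlus) := by
  have hle : ∀ r ∈ realSpectrum A.op, 0 ≤ r := fun r hr =>
    not_lt.1 fun hr0 => (h ▸ ⟨hr, hr0⟩ : r ∈ (∅ : Set ℝ))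
  have h1 := A.zero_mem_realSpectrum_op_of_not_injective (A.zeroIsIsolatedEigenvalue_iff.1 h0).1
  obtain rfl : a = 0 := (ha.2 h1).antisymm (hle a ha.1)
  have ha'0 : 0 ≤ a' := by
    by_contra! hneg
    exact hneg.not_ge (hle a' ((A.mem_realSpectrum_Atilde_iff hneg.ne).1 ha'.1))
  rw [← A.zero_mem_realSpectrum_Atilde_iff h0]
  refine ⟨⟨fun h => h ▸ ha'.1, fun h => (ha'.2 h).antisymm ha'0⟩, fun hk => ?_⟩
  have hne : a' ≠ 0 := fun h => (A.zero_mem_realSpectrum_Atilde_iff h0).1 (h ▸ ha'.1) hk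
  have hlt : 0 < a' := ha'0.lt_of_ne hne.symm
  have hmu : (a' : EReal) = A.muPlus := by
    have hg : IsLeast ((fun r : ℝ => (r : EReal)) '' (realSpectrum A.op ∩ Ioi 0)) a' := by
      refine ⟨⟨a', ⟨(A.mem_realSpectrum_Atilde_iff hne).1 ha'.1, hlt⟩, rfl⟩, ?_⟩
      rintro _ ⟨r, ⟨hr, hr0 : 0 < r⟩, rfl⟩
      exact EReal.coe_le_coe_iff.2 (ha'.2 ((A.mem_realSpectrum_Atilde_iff hr0.ne').2 hr))
    exact hg.isGLB.sInf_eq.symm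
  exact ⟨hmu, hmu ▸ EReal.coe_pos.2 hlt⟩

lemma coNumericalRange_of_spectrum_eq (h0 : A.ZeroIsIsolatedEigenvalue)
    (h : spectrum ℂ A.op = {0}) :
    (A.op = 0 ∧ A.coNumericalRange = ∅) ∨
      (A.op.ker ≠ (A.op ∘L A.op).ker ∧ A.coNumericalRange = {0}) := by
  by_cases hA : A.op = 0
  · refine .inl ⟨hA, ?_⟩
    ext r
    simp [coNumericalRange, hA]
  refine .inr ?_
  have hne := A.realSpectrum_Atilde_nonempty hA
  have hsub : realSpectrum A.Atilde ⊆ {0} := by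
    intro r hr
    by_contra hr0
    have h1 : (r : ℂ) ∈ spectrum ℂ A.op := (A.mem_realSpectrum_Atilde_iff hr0).1 hr
    rw [h, mem_singleton_iff, Complex.ofReal_eq_zero] at h1
    exact hr0 h1
  have heq : realSpectrum A.Atilde = {0} := hne.subset_singleton_iff.1 hsub
  refine ⟨(A.zero_mem_realSpectrum_Atilde_iff h0).1 (heq ▸ mem_singleton 0), ?_⟩
  -- The interval degenerates to a point, which determines the nonempty range itself and not only
  -- its closure.
  have hcl := A.closure_coNumericalRange hA (a := 0) (b := 0) (heq ▸ isLeast_singleton)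
    (heq ▸ isGreatest_singleton)
  rw [Icc_self] at hcl
  exact (A.coNumericalRange_nonempty hA).subset_singleton_iff.1 (hcl ▸ subset_closure)

end KreinSpace.BoundedNonneg

theorem mainTheorem5 {K : Type*} [NormedAddCommGroup K] [NormedSpace ℂ K] (𝒦 : KreinSpace K)
    (A : 𝒦.BoundedNonneg) :
    -- the spectra are real, so that minima and maxima are taken over subsets of `ℝ`
    (∀ z ∈ spectrum ℂ A.op, z.im = 0) ∧ (∀ z ∈ spectrum ℂ A.Atilde, z.im = 0) ∧
    (A.op ≠ 0 →
      ∃ a b a' b' : ℝ,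
        IsLeast (realSpectrum A.op) a ∧ IsGreatest (realSpectrum A.op) b ∧
        IsLeast (realSpectrum A.Atilde) a' ∧ IsGreatest (realSpectrum A.Atilde) b' ∧
        closure A.coNumericalRange = Icc a' b' ∧
        ((¬ A.ZeroIsIsolatedEigenvalue ∨
            ((realSpectrum A.op ∩ Ioi 0).Nonempty ∧ (realSpectrum A.op ∩ Iio 0).Nonempty)) →
          a' = a ∧ b' = b) ∧
        (A.ZeroIsIsolatedEigenvalue →
          (realSpectrum A.op ∩ Ioi 0 = ∅ → (realSpectrum A.op ∩ Iio 0).Nonempty →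
            a' = a ∧ (b' = b ↔ A.op.ker ≠ (A.op ∘L A.op).ker) ∧
            (A.op.ker = (A.op ∘L A.op).ker → (b' : EReal) = A.muMinus ∧ A.muMinus < 0)) ∧
          ((realSpectrum A.op ∩ Ioi 0).Nonempty → realSpectrum A.op ∩ Iio 0 = ∅ →
            b' = b ∧ (a' = a ↔ A.op.ker ≠ (A.op ∘L A.op).ker) ∧
            (A.op.ker = (A.op ∘L A.op).ker → (a' : EReal) = A.muPlus ∧ 0 < A.muPlus)))) ∧
    (A.ZeroIsIsolatedEigenvalue → spectrum ℂ A.op = {0} →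
      (A.op = 0 ∧ A.coNumericalRange = ∅) ∨
      (A.op.ker ≠ (A.op ∘L A.op).ker ∧ A.coNumericalRange = {0})) := by

  have := 𝒦.completeSpace
  refine ⟨fun z hz => A.im_eq_zero_of_mem_spectrum_op hz,
    fun z hz => A.im_eq_zero_of_mem_spectrum_Atilde hz, fun hA => ?_,
    A.coNumericalRange_of_spectrum_eq⟩
  have hc := KreinSpace.BoundedNonneg.realSpectrum_isCompact A.op
  have hc' := KreinSpace.BoundedNonneg.realSpectrum_isCompact A.Atilde
  obtain ⟨a, ha⟩ := hc.exists_isLeast (A.realSpectrum_op_nonempty hA)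
  obtain ⟨b, hb⟩ := hc.exists_isGreatest (A.realSpectrum_op_nonempty hA)
  obtain ⟨a', ha'⟩ := hc'.exists_isLeast (A.realSpectrum_Atilde_nonempty hA)
  obtain ⟨b', hb'⟩ := hc'.exists_isGreatest (A.realSpectrum_Atilde_nonempty hA)
  refine ⟨a, b, a', b', ha, hb, ha', hb', A.closure_coNumericalRange hA ha' hb', ?_, ?_⟩
  · rintro (h | ⟨hpos, hneg⟩)
    · rw [A.realSpectrum_Atilde_of_not_isolated h] at ha' hb'
      exact ⟨ha'.unique ha, hb'.unique hb⟩
    · exact ⟨KreinSpace.BoundedNonneg.isLeast_realSpectrum_eq ha ha' hneg,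
        KreinSpace.BoundedNonneg.isGreatest_realSpectrum_eq hb hb' hpos⟩
  · exact fun h0 => ⟨fun hpos hneg =>
      ⟨KreinSpace.BoundedNonneg.isLeast_realSpectrum_eq ha ha' hneg,
        KreinSpace.BoundedNonneg.isGreatest_realSpectrum_of_nonpos hb hb' h0 hpos⟩,
      fun hpos hneg =>
        ⟨KreinSpace.BoundedNonneg.isGreatest_realSpectrum_eq hb hb' hpos,
          KreinSpace.BoundedNonneg.isLeast_realSpectrum_of_nonneg ha ha' h0 hneg⟩⟩
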